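/- Conventions: $\mathbb N=\{1,2,3,\dots\}$. For $n\in\mathbb N$ let $V_n$ be the set of $f\in C_0(\mathbb R)$ (complex-valued) with $f(\mathbb R)\subseteq[0,1]$, $f=1$ on $[-n,n]$ and $\operatorname{supp} f\subseteq[-n-1,n+1]$. Let $\bigotimes_{i=1}^\infty C_0(\mathbb R)$ be the algebraic tensor product (universal for maps on $C_0(\mathbb R)^{\mathbb N}$ that are linear in each entry), with the $*$-algebra structure given by entrywise product and involution of elementary tensors. For $\mathbf f=(f_1,f_2,\dots)\in C_0(\mathbb R)^{\mathbb N}$ let $\langle\mathbf f\rangle$ be the linear span of the elementary tensors $\bigotimes_n y_n$ with $y_n=f_n$ for all but finitely many $n$, and let $*\text{-alg}(\langle\mathbf f\rangle)$ be the $*$-subalgebra generated by $\langle\mathbf f\rangle$. For a $*$-representation $\rho$ of a $*$-algebra by bounded operators on a Hilbert space $\mathcal H$, its essential subspace is the closed linear span of all $\rho(a)x$ ($x\in\mathcal H$), and $\rho$ is non-degenerate if this is $\mathcal H$. Lemma. Let $(k_n)$ be a sequence in $\mathbb N$, let $\mathbf f\in\prod_{n}V_{k_n}$, and let $\pi_k:C_0(\mathbb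 R)\to B(\mathcal H)$, $k\in\mathbb N$, be (possibly degenerate) $*$-representations on a complex Hilbert space $\mathcal H$ whose ranges commute with each other. (i) For all $k,\ell\in\mathbb N$ the strong limit $F_k^{(\ell)}:=\operatorname{s-lim}_{n\to\infty}\pi_k(f_k^\ell)\pi_{k+1}(f_{k+1}^\ell)\cdots\pi_n(f_n^\ell)\in B(\mathcal H)$ exists, and $0\le F_k^{(\ell)}\le\mathbf 1$. (ii) For each $\ell$ the sequence $(F_k^{(\ell)})_k$ is increasing, and $P[\mathbf f]:=\operatorname{s-lim}_{k\to\infty}F_k^{(\ell)}$ exists, is an orthogonal projection, does not depend on $\ell$, and satisfies $F_k^{(\ell)}P[\mathbf f]=F_k^{(\ell)}$ for all $k,\ell$. (iii) Let $Q\in B(\mathcal H)$ satisfy $0\le Q\le\mathbf 1$ and commute with $\pi_k(C_0(\mathbb R))$ for every $k$. All elements $A=A_1\otimes\cdots\otimes A_m\otimes f_{m+1}^\ell\otimes f_{m+2}^\ell\otimes\cdots$ ($A_i\in C_0(\mathbb R)$, $\ell\in\mathbb N$, $m\ge0$) lie in $*\text{-alg}(\langle\mathbf f\rangle)$, and there is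 exactly one $*$-representation $\pi_Q:*\text{-alg}(\langle\mathbf f\rangle)\to B(\mathcal H)$ with $$\pi_Q(A)=\pi_1(A_1)\cdots\pi_m(A_m)\,F_{m+1}^{(\ell)}\,Q^\ell$$ for all such $A$. (iv) $\pi_Q$ is non-degenerate if and only if all $\pi_i$ are non-degenerate, $P[\mathbf f]=\mathbf 1$ and $\operatorname{Ker}Q=\{0\}$. If $\pi_Q$ is degenerate, $\operatorname{Ker}Q=\{0\}$ and all $\pi_j$ are non-degenerate, then $P[\mathbf f]$ is the orthogonal projection onto the essential subspace of $\pi_Q$. -/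

import Mathlib

open Filter Topology
open scoped TensorProduct ZeroAtInfty InnerProductSpace

namespace InfTensor

/-- The complex C*-algebra `C₀(ℝ)`. -/
abbrev C0 : Type := C₀(ℝ, ℂ)

/-- The algebraic tensor product of countably many copies of `C₀(ℝ)`: the universal target of
maps on sequences in `C₀(ℝ)` that are linear in every entry. -/
abbrev TensorC0 : Type := ⨂[ℂ] _ : ℕ, C0

noncomputable section

instance instNonUnitalSemiring : NonUnitalSemiring TensorC0 :=
  PiTensorProduct.instNonUnitalSemiring

instance instNonUnitalRing : NonUnitalRing TensorC0 where
  __ := instNonUnitalSemiring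
  __ := (inferInstance : AddCommGroup TensorC0)

instance instSMulCommClass : SMulCommClass ℂ TensorC0 TensorC0 where
  smul_comm r x y := by
    simp only [smul_eq_mul, PiTensorProduct.mul_def, map_smul]

instance instIsScalarTower : IsScalarTower ℂ TensorC0 TensorC0 where
  smul_assoc r x y := by
    simp only [smul_eq_mul, PiTensorProduct.mul_def, map_smul, LinearMap.smul_apply]

/-- The additive, conjugate-linear map with `⊗ aₙ ↦ ⊗ aₙ*`. -/
def starHom : TensorC0 →+ TensorC0 :=
  PiTensorProduct.liftAddHom
    (fun p : ℂ × (ℕ → C0) => PiTensorProduct.tprodCoeff ℂ (star p.1) (star p.2))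
    (by
      intro r f i hf
      exact PiTensorProduct.zero_tprodCoeff' _ _ i (by simp [hf]))
    (by
      intro f
      simp only [star_zero]
      exact PiTensorProduct.zero_tprodCoeff (R := ℂ) (star f))
    (by
      intro inst z f i a b
      have h (c : C0) : star (Function.update f i c) = Function.update (star f) i (star c) := by
        funext j
        by_cases hj : j = i
        · subst hj; simp
        · simp [hj]
      simp only [h, star_add]
      exact PiTensorProduct.add_tprodCoeff (R := ℂ) _ _ i _ _)
    (by
      intro z₁ z₂ f
      simp only [star_add]
      exact PiTensorProduct.add_tprodCoeff' (R := ℂ) _ _ _)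
    (by
      intro inst z f i r
      have h : star (Function.update f i (r • f i))
          = Function.update (star f) i (star r • (star f) i) := by
        funext j
        by_cases hj : j = i
        · subst hj; simp
        · simp [hj]
      simp only [h, star_mul']
      rw [PiTensorProduct.smul_tprodCoeff]
      simp [smul_eq_mul])

theorem starHom_smul_tprod (r : ℂ) (a : ℕ → C0) :
    starHom (r • PiTensorProduct.tprod ℂ a) = star r • PiTensorProduct.tprod ℂ (star a) := by
  rw [← PiTensorProduct.tprodCoeff_eq_smul_tprod, ← PiTensorProduct.tprodCoeff_eq_smul_tprod]
  rfl

theorem starHom_starHom (x : TensorC0) : starHom (starHom x) = x := by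
  induction x using PiTensorProduct.induction_on with
  | smul_tprod r a => simp only [starHom_smul_tprod, star_star]
  | add x y hx hy => rw [map_add, map_add, hx, hy]

theorem starHom_smul (r : ℂ) (x : TensorC0) : starHom (r • x) = star r • starHom x := by
  induction x using PiTensorProduct.induction_on with
  | smul_tprod s a => rw [smul_smul, starHom_smul_tprod, starHom_smul_tprod, star_mul', smul_smul]
  | add x y hx hy => rw [smul_add, map_add, map_add, hx, hy, smul_add]

theorem starHom_mul (x y : TensorC0) : starHom (x * y) = starHom y * starHom x := by
  induction x using PiTensorProduct.induction_on with
  | smul_tprod r a =>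
    induction y using PiTensorProduct.induction_on with
    | smul_tprod s b =>
      rw [PiTensorProduct.smul_tprod_mul_smul_tprod, starHom_smul_tprod, starHom_smul_tprod,
        starHom_smul_tprod, PiTensorProduct.smul_tprod_mul_smul_tprod, star_mul, star_mul]
    | add y z hy hz => rw [mul_add, map_add, map_add, hy, hz, add_mul]
  | add x z hx hz => rw [add_mul, map_add, map_add, hx, hz, mul_add]

/-- The involution of the algebraic tensor product, `(⊗ aₙ)* = ⊗ aₙ*`. -/
instance instStarRing : StarRing TensorC0 where
  star := starHom
  star_involutive := starHom_starHom
  star_mul := starHom_mul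
  star_add := map_add starHom

instance instStarModule : StarModule ℂ TensorC0 where
  star_smul := starHom_smul

theorem star_tprod (a : ℕ → C0) :
    star (PiTensorProduct.tprod ℂ a) = PiTensorProduct.tprod ℂ (star a) := by
  have h := starHom_smul_tprod 1 a
  simp only [star_one, one_smul] at h
  exact h

/-- `V n`: the `f ∈ C₀(ℝ)` with values in `[0,1]`, equal to `1` on `[-n, n]` and with support in
`[-n-1, n+1]`. -/
def V (n : ℕ) : Set C0 :=
  {f | (∀ x, ∃ t ∈ Set.Icc (0 : ℝ) 1, f x = (t : ℂ)) ∧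
    (∀ x ∈ Set.Icc (-(n : ℝ)) n, f x = 1) ∧
    tsupport f ⊆ Set.Icc (-(n : ℝ) - 1) (n + 1)}

/-- The power `f ^ ℓ`, `ℓ ≥ 1`, in the non-unital algebra `C₀(ℝ)`. -/
def ppow (f : C0) (l : ℕ+) : C0 where
  toFun x := f x ^ (l : ℕ)
  continuous_toFun := by fun_prop
  zero_at_infty' := by
    have h := (zero_at_infty f).pow (l : ℕ)
    rwa [zero_pow l.ne_zero] at h

/-- `⟨x⟩`: the span of the elementary tensors `⊗ yₙ` with `yₙ = xₙ` for all but finitely many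
`n`. -/
def bracket (x : ℕ → C0) : Submodule ℂ TensorC0 :=
  Submodule.span ℂ {z | ∃ y : ℕ → C0, {n | x n ≠ y n}.Finite ∧ z = PiTensorProduct.tprod ℂ y}

/-- `*-alg(⟨f⟩)`: the *-subalgebra generated by `⟨f⟩`. -/
def starAlg (f : ℕ → C0) : NonUnitalStarSubalgebra ℂ TensorC0 :=
  NonUnitalStarAlgebra.adjoin ℂ (bracket f : Set TensorC0)

/-- `A₀ ⊗ ⋯ ⊗ A_{m-1} ⊗ f_m ^ ℓ ⊗ f_{m+1} ^ ℓ ⊗ ⋯` (the entries of `A` from `m` on are not used). -/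
def elem (f : ℕ → C0) (m : ℕ) (l : ℕ+) (A : ℕ → C0) : TensorC0 :=
  PiTensorProduct.tprod ℂ (fun n => if n < m then A n else ppow (f n) l)

variable {H : Type*} [NormedAddCommGroup H] [InnerProductSpace ℂ H]

/-- The ordered product `T k * T (k+1) * ⋯ * T (n-1)`. -/
def orderedProd (T : ℕ → H →L[ℂ] H) (k n : ℕ) : H →L[ℂ] H :=
  ((List.Ico k n).map T).prod

/-- `S` is the limit of the sequence `T` in the strong operator topology. -/
def IsStrongLimit (T : ℕ → H →L[ℂ] H) (S : H →L[ℂ] H) : Prop :=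
  ∀ x, Tendsto (fun n => T n x) atTop (𝓝 (S x))

/-- The essential subspace of a family of operators: the closed span of all `ρ a x`. -/
def essentialSubspace {B : Type*} (ρ : B → H →L[ℂ] H) : Submodule ℂ H :=
  (Submodule.span ℂ {v | ∃ a x, v = ρ a x}).topologicalClosure

/-- Non-degeneracy: the vectors `ρ a x` span a dense subspace. -/
def IsNondegenerate {B : Type*} (ρ : B → H →L[ℂ] H) : Prop :=
  essentialSubspace ρ = ⊤

end

end InfTensor

/-! The operators `T i = π i (f i)` commute and lie in `[0, 1]`, because *-homomorphisms of
C*-algebras are positive and contractive. Their ordered products therefore decrease with the upper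
end, and bounded monotone sequences converge strongly; this gives `F k`. Multiplication is strongly
continuous on bounded sets, so the limit for exponent `l` is simply `F k ^ l`. The identity `T k * F
(k + 1) = F k` shows that `F k` increases, to some `P`; letting `n → ∞` in `T k ⋯ T (n - 1) * F n =
F k` yields `F k * P = F k`, then `P * P = P`, and the powers `F k ^ l` tend to `P ^ l = P`.

For the representation, `π₀(y₀) ⋯ π_{m-1}(y_{m-1}) F_m^l Q^l` does not depend on the cut `m`, again
by `T k * F (k + 1) = F k`, and the exponent `l` is determined by `y` because each `f n` takes the
value `1/2`. Extended by zero to sequences without such a tail, it is multilinear, since changing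
one entry does not affect the tail. The universal property gives a linear map on the whole tensor
product; it is multiplicative and *-preserving on the span of the tensors with tail a power of `f`,
which contains `starAlg f` (`starAlg_le_span`).

A *-representation is non-degenerate exactly when no nonzero vector is killed by all its operators.
For injective `Q` and non-degenerate `π i` these vectors form `ker P`
(`tensorRepresentation_kernel`), which gives the last part. -/

namespace InfTensor

/-! ### Strong limits and bounded monotone sequences of operators -/

section StrongLimits

variable {H : Type*} [NormedAddCommGroup H] [InnerProductSpace ℂ H]

theorem mul_apply_eq_zero (A : H →L[ℂ] H) {B : H →L[ℂ] H} {v : H} (h : B v = 0) :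
    (A * B) v = 0 :=
  (congrArg A h).trans (map_zero A)

theorem IsStrongLimit.unique {T : ℕ → H →L[ℂ] H} {S S' : H →L[ℂ] H} (h : IsStrongLimit T S)
    (h' : IsStrongLimit T S') : S = S' :=
  ContinuousLinearMap.ext fun x => tendsto_nhds_unique (h x) (h' x)

theorem IsStrongLimit.congr' {T T' : ℕ → H →L[ℂ] H} {S : H →L[ℂ] H} (h : IsStrongLimit T S)
    (h' : T =ᶠ[atTop] T') : IsStrongLimit T' S := fun x =>
  (h x).congr' (h'.mono fun n hn => by rw [hn])

theorem isStrongLimit_const (S : H →L[ℂ] H) : IsStrongLimit (fun _ => S) S := fun _ =>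
  tendsto_const_nhds

theorem IsStrongLimit.sub {T T' : ℕ → H →L[ℂ] H} {S S' : H →L[ℂ] H} (h : IsStrongLimit T S)
    (h' : IsStrongLimit T' S') : IsStrongLimit (fun n => T n - T' n) (S - S') := fun x =>
  (h x).sub (h' x)

/-- Uniform boundedness of the left factors controls `T n (T' n x - S' x)`; the rest is convergence
at the fixed vector `S' x`. -/
theorem IsStrongLimit.mul {T T' : ℕ → H →L[ℂ] H} {S S' : H →L[ℂ] H} {C : ℝ}
    (hC : ∀ n, ‖T n‖ ≤ C) (h : IsStrongLimit T S) (h' : IsStrongLimit T' S') :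
    IsStrongLimit (fun n => T n * T' n) (S * S') := by
  intro x
  have h1 : Tendsto (fun n => T n (T' n x - S' x)) atTop (𝓝 0) := by
    refine squeeze_zero_norm (a := fun n => C * ‖T' n x - S' x‖) (fun n => ?_) ?_
    · exact (T n).le_of_opNorm_le (hC n) _
    · have := ((h' x).sub_const (S' x)).norm.const_mul C
      simpa using this
  have h2 := h1.add (h (S' x))
  simpa using h2

theorem IsStrongLimit.const_mul {T : ℕ → H →L[ℂ] H} {S : H →L[ℂ] H} (h : IsStrongLimit T S)
    (A : H →L[ℂ] H) : IsStrongLimit (fun n => A * T n) (A * S) :=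
  IsStrongLimit.mul (fun _ => le_rfl) (isStrongLimit_const A) h

theorem IsStrongLimit.mul_const {T : ℕ → H →L[ℂ] H} {S : H →L[ℂ] H} (h : IsStrongLimit T S)
    (A : H →L[ℂ] H) : IsStrongLimit (fun n => T n * A) (S * A) := fun x => h (A x)

theorem IsStrongLimit.commute {T : ℕ → H →L[ℂ] H} {S A : H →L[ℂ] H} (h : IsStrongLimit T S)
    (hA : ∀ n, Commute A (T n)) : Commute A S :=
  (h.const_mul A).unique ((h.mul_const A).congr' (.of_forall fun n => (hA n).eq.symm))

theorem IsStrongLimit.pow {T : ℕ → H →L[ℂ] H} {S : H →L[ℂ] H} (hT : ∀ n, ‖T n‖ ≤ 1)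
    (h : IsStrongLimit T S) (l : ℕ) : IsStrongLimit (fun n => T n ^ l) (S ^ l) := by
  induction l with
  | zero => simpa using isStrongLimit_const (1 : H →L[ℂ] H)
  | succ l ih => simpa only [pow_succ'] using h.mul hT ih

theorem IsStrongLimit.nonneg {T : ℕ → H →L[ℂ] H} {S : H →L[ℂ] H} (h : IsStrongLimit T S)
    (hT : ∀ n, 0 ≤ T n) : 0 ≤ S := by
  simp only [ContinuousLinearMap.nonneg_iff_isPositive] at hT ⊢
  refine (ContinuousLinearMap.isPositive_iff_complex S).2 fun x => ?_
  have h1 : Tendsto (fun n => ⟪T n x, x⟫_ℂ) atTop (𝓝 ⟪S x, x⟫_ℂ) :=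
    (h x).inner tendsto_const_nhds
  have h2 : Tendsto (fun n => (RCLike.re ⟪T n x, x⟫_ℂ : ℝ)) atTop (𝓝 (RCLike.re ⟪S x, x⟫_ℂ)) :=
    (RCLike.continuous_re.tendsto _).comp h1
  have h3 n := (ContinuousLinearMap.isPositive_iff_complex (T n)).1 (hT n) x
  refine ⟨?_, ge_of_tendsto' h2 fun n => (h3 n).2⟩
  have h4 : Tendsto (fun n => ((RCLike.re ⟪T n x, x⟫_ℂ : ℝ) : ℂ)) atTop
      (𝓝 ((RCLike.re ⟪S x, x⟫_ℂ : ℝ) : ℂ)) := (Complex.continuous_ofReal.tendsto _).comp h2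
  exact tendsto_nhds_unique h4 (h1.congr fun n => (h3 n).1.symm)

variable [CompleteSpace H]

theorem IsStrongLimit.le_of_le {T T' : ℕ → H →L[ℂ] H} {S S' : H →L[ℂ] H} (h : IsStrongLimit T S)
    (h' : IsStrongLimit T' S') (hT : ∀ n, T n ≤ T' n) : S ≤ S' :=
  sub_nonneg.1 ((h'.sub h).nonneg fun n => sub_nonneg.2 (hT n))

/-- `T - T * T = T * (1 - T)` is positive as a product of commuting positive operators. This turns
convergence of quadratic forms into convergence in norm. -/
theorem norm_apply_sq_le {T : H →L[ℂ] H} (h0 : 0 ≤ T) (h1 : T ≤ 1) (x : H) :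
    ‖T x‖ ^ 2 ≤ (RCLike.re ⟪T x, x⟫_ℂ : ℝ) := by
  have h2 : 0 ≤ T - T * T := by
    have h3 := Commute.mul_nonneg h0 (sub_nonneg.2 h1)
      ((Commute.one_right T).sub_right (Commute.refl T))
    simpa [mul_sub] using h3
  have h3 := ((ContinuousLinearMap.nonneg_iff_isPositive _).1 h2).re_inner_nonneg_left x
  have hs : IsSelfAdjoint T := .of_nonneg h0
  have h4 : ⟪T (T x), x⟫_ℂ = ⟪T x, T x⟫_ℂ := by
    rw [← ContinuousLinearMap.adjoint_inner_right, hs.adjoint_eq]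
  have h5 : (T - T * T) x = T x - T (T x) := rfl
  rw [h5, inner_sub_left, h4, map_sub, inner_self_eq_norm_sq] at h3
  linarith

/-- The numbers `⟪T n x, x⟫` decrease and are bounded below, hence Cauchy; `norm_apply_sq_le`,
applied to `T m - T n ∈ [0, 1]`, makes `T n x` Cauchy too. -/
theorem exists_isStrongLimit_of_antitone {T : ℕ → H →L[ℂ] H} (hT : Antitone T)
    (h0 : ∀ n, 0 ≤ T n) (h1 : ∀ n, T n ≤ 1) : ∃ S, IsStrongLimit T S := by
  have key (x : H) : ∃ y, Tendsto (fun n => T n x) atTop (𝓝 y) := by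
    set r : ℕ → ℝ := fun n => RCLike.re ⟪T n x, x⟫_ℂ with hr
    have hdiff {m n : ℕ} (hmn : m ≤ n) : ‖T m x - T n x‖ ^ 2 ≤ r m - r n := by
      have := norm_apply_sq_le (sub_nonneg.2 (hT hmn))
        ((sub_le_self _ (h0 n)).trans (h1 m)) x
      simpa [hr, inner_sub_left] using this
    have hanti : Antitone r := fun m n hmn => by
      have := (sq_nonneg _).trans (hdiff hmn); linarith
    have hbdd : BddBelow (Set.range r) := ⟨0, by
      rintro _ ⟨n, rfl⟩
      exact ((ContinuousLinearMap.nonneg_iff_isPositive _).1 (h0 n)).re_inner_nonneg_left x⟩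
    have hc : CauchySeq r := (tendsto_atTop_ciInf hanti hbdd).cauchySeq
    refine cauchySeq_tendsto_of_complete (Metric.cauchySeq_iff'.2 fun ε hε => ?_)
    obtain ⟨N, hN⟩ := Metric.cauchySeq_iff'.1 hc (ε ^ 2) (by positivity)
    refine ⟨N, fun n hn => ?_⟩
    have h2 : r N - r n < ε ^ 2 := (le_abs_self _).trans_lt (by
      simpa [Real.dist_eq, abs_sub_comm] using hN n hn)
    rw [dist_comm, dist_eq_norm]
    exact lt_of_pow_lt_pow_left₀ 2 hε.le ((hdiff hn).trans_lt h2)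
  choose g hg using key
  exact ⟨continuousLinearMapOfTendsto (fun n => T n) (tendsto_pi_nhds.2 hg), hg⟩

theorem exists_isStrongLimit_of_monotone {T : ℕ → H →L[ℂ] H} (hT : Monotone T)
    (h0 : ∀ n, 0 ≤ T n) (h1 : ∀ n, T n ≤ 1) : ∃ S, IsStrongLimit T S := by
  obtain ⟨S, hS⟩ := exists_isStrongLimit_of_antitone (T := fun n => 1 - T n)
    (fun m n h => sub_le_sub_left (hT h) 1) (fun n => sub_nonneg.2 (h1 n))
    (fun n => sub_le_self _ (h0 n))
  exact ⟨1 - S, ((isStrongLimit_const 1).sub hS).congr' (.of_forall fun n => by simp)⟩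

theorem mul_le_right_of_commute {A B : H →L[ℂ] H} (hA : A ≤ 1) (hB : 0 ≤ B) (h : Commute A B) :
    A * B ≤ B := by
  have := Commute.mul_nonneg (sub_nonneg.2 hA) hB ((Commute.one_left B).sub_left h)
  rwa [sub_mul, one_mul, sub_nonneg] at this

end StrongLimits

/-! ### Ordered products of commuting operators and their tail limits -/

section OrderedProd

variable {H : Type*} [NormedAddCommGroup H] [InnerProductSpace ℂ H]

theorem orderedProd_of_le (T : ℕ → H →L[ℂ] H) {k n : ℕ} (h : n ≤ k) : orderedProd T k n = 1 := by
  simp [orderedProd, List.Ico.eq_nil_of_le h]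

theorem orderedProd_mul_orderedProd (T : ℕ → H →L[ℂ] H) {k m n : ℕ} (hkm : k ≤ m) (hmn : m ≤ n) :
    orderedProd T k m * orderedProd T m n = orderedProd T k n := by
  simp [orderedProd, ← List.Ico.append_consecutive hkm hmn]

theorem orderedProd_self_succ (T : ℕ → H →L[ℂ] H) (k : ℕ) : orderedProd T k (k + 1) = T k := by
  simp [orderedProd]

theorem orderedProd_succ (T : ℕ → H →L[ℂ] H) {k n : ℕ} (h : k ≤ n) :
    orderedProd T k (n + 1) = orderedProd T k n * T n := by
  rw [← orderedProd_mul_orderedProd T h n.le_succ, orderedProd_self_succ]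

theorem orderedProd_eq_mul (T : ℕ → H →L[ℂ] H) {k n : ℕ} (h : k < n) :
    orderedProd T k n = T k * orderedProd T (k + 1) n := by
  rw [← orderedProd_mul_orderedProd T k.le_succ h, orderedProd_self_succ]

theorem orderedProd_congr {T T' : ℕ → H →L[ℂ] H} {k n : ℕ} (h : ∀ i, k ≤ i → i < n → T i = T' i) :
    orderedProd T k n = orderedProd T' k n := by
  unfold orderedProd
  congr 1
  refine List.map_congr_left fun i hi => ?_
  rw [List.Ico.mem] at hi
  exact h i hi.1 hi.2

theorem commute_orderedProd {T : ℕ → H →L[ℂ] H} {A : H →L[ℂ] H} (h : ∀ i, Commute A (T i))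
    (k n : ℕ) : Commute A (orderedProd T k n) := by
  refine Commute.list_prod_right _ _ fun B hB => ?_
  obtain ⟨i, -, rfl⟩ := List.mem_map.1 hB
  exact h i

theorem orderedProd_mul {S T : ℕ → H →L[ℂ] H} (h : ∀ i j, Commute (S i) (T j)) (k n : ℕ) :
    orderedProd (fun i => S i * T i) k n = orderedProd S k n * orderedProd T k n := by
  rcases le_total n k with hk | hk
  · simp [orderedProd_of_le _ hk]
  induction n, hk using Nat.le_induction with
  | base => simp [orderedProd_of_le]
  | succ n hk ih =>
    simp only [orderedProd_succ _ hk, ih]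
    exact (commute_orderedProd (h n) k n).symm.mul_mul_mul_comm _ _

theorem orderedProd_pow {T : ℕ → H →L[ℂ] H} (h : ∀ i j, Commute (T i) (T j)) (k n l : ℕ) :
    orderedProd (fun i => T i ^ l) k n = orderedProd T k n ^ l := by
  induction l with
  | zero => simp [orderedProd]
  | succ l ih => simp only [pow_succ, orderedProd_mul fun i j => (h i j).pow_left l, ih]

theorem orderedProd_mul_tailLimit {T F : ℕ → H →L[ℂ] H}
    (hF : ∀ k, IsStrongLimit (orderedProd T k) (F k)) {k m : ℕ} (hkm : k ≤ m) :
    orderedProd T k m * F m = F k :=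
  ((hF m).const_mul _).unique ((hF k).congr' (by
    filter_upwards [eventually_ge_atTop m] with n hn
    rw [orderedProd_mul_orderedProd T hkm hn]))

theorem mul_tailLimit_succ {T F : ℕ → H →L[ℂ] H}
    (hF : ∀ k, IsStrongLimit (orderedProd T k) (F k)) (k : ℕ) : T k * F (k + 1) = F k := by
  simpa [orderedProd_self_succ] using orderedProd_mul_tailLimit hF k.le_succ

variable [CompleteSpace H]

theorem star_orderedProd {T : ℕ → H →L[ℂ] H} (h : ∀ i j, Commute (T i) (T j)) (k n : ℕ) :
    star (orderedProd T k n) = orderedProd (fun i => star (T i)) k n := by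
  rcases le_total n k with hk | hk
  · simp [orderedProd_of_le _ hk]
  induction n, hk using Nat.le_induction with
  | base => simp [orderedProd_of_le]
  | succ n hk ih =>
    rw [orderedProd_succ _ hk, (commute_orderedProd (h n) k n).symm.eq, star_mul, ih,
      orderedProd_succ _ hk]

theorem orderedProd_mem_Icc {T : ℕ → H →L[ℂ] H} (h : ∀ i j, Commute (T i) (T j))
    (hT : ∀ i, T i ∈ Set.Icc 0 1) (k n : ℕ) : orderedProd T k n ∈ Set.Icc 0 1 := by
  rcases le_total n k with hk | hk
  · simp [orderedProd_of_le _ hk]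
  induction n, hk using Nat.le_induction with
  | base => simp [orderedProd_of_le]
  | succ n hk ih =>
    have hc := commute_orderedProd (h n) k n
    rw [orderedProd_succ _ hk, hc.symm.eq]
    exact ⟨Commute.mul_nonneg (hT n).1 ih.1 hc,
      (mul_le_right_of_commute (hT n).2 ih.1 hc).trans ih.2⟩

theorem antitone_orderedProd {T : ℕ → H →L[ℂ] H} (h : ∀ i j, Commute (T i) (T j))
    (hT : ∀ i, T i ∈ Set.Icc 0 1) (k : ℕ) : Antitone (orderedProd T k) := by
  refine antitone_nat_of_succ_le fun n => ?_
  rcases lt_or_ge n k with hk | hk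
  · simp [orderedProd_of_le _ hk, orderedProd_of_le _ hk.le]
  · have hc := commute_orderedProd (h n) k n
    rw [orderedProd_succ _ hk, hc.symm.eq]
    exact mul_le_right_of_commute (hT n).2 (orderedProd_mem_Icc h hT k n).1 hc

theorem norm_le_one_of_mem_Icc {T : H →L[ℂ] H} (h : T ∈ Set.Icc 0 1) : ‖T‖ ≤ 1 :=
  (CStarAlgebra.norm_le_one_iff_of_nonneg T h.1).2 h.2

theorem pow_mem_Icc {T : H →L[ℂ] H} (h : T ∈ Set.Icc 0 1) (l : ℕ) : T ^ l ∈ Set.Icc 0 1 :=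
  ⟨CStarAlgebra.pow_nonneg h.1 l, by
    simpa using CStarAlgebra.pow_antitone h.1 h.2 (Nat.zero_le l)⟩

/-- Tail limits of the ordered products of commuting operators in `[0, 1]`. -/
theorem exists_tailLimit {T : ℕ → H →L[ℂ] H} (h : ∀ i j, Commute (T i) (T j))
    (hT : ∀ i, T i ∈ Set.Icc 0 1) :
    ∃ F : ℕ → H →L[ℂ] H, (∀ k, IsStrongLimit (orderedProd T k) (F k)) ∧
      (∀ k, F k ∈ Set.Icc 0 1) := by
  choose F hF using fun k => exists_isStrongLimit_of_antitone (antitone_orderedProd h hT k)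
    (fun n => (orderedProd_mem_Icc h hT k n).1) (fun n => (orderedProd_mem_Icc h hT k n).2)
  exact ⟨F, hF, fun k => ⟨(hF k).nonneg fun n => (orderedProd_mem_Icc h hT k n).1,
    (hF k).le_of_le (isStrongLimit_const 1) fun n => (orderedProd_mem_Icc h hT k n).2⟩⟩

/-- The tail limits increase to a projection, as do all their positive powers. -/
theorem exists_tailProjection {T F : ℕ → H →L[ℂ] H} (h : ∀ i j, Commute (T i) (T j))
    (hT : ∀ i, T i ∈ Set.Icc 0 1) (hF : ∀ k, IsStrongLimit (orderedProd T k) (F k))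
    (hF' : ∀ k, F k ∈ Set.Icc 0 1) :
    ∃ P : H →L[ℂ] H, IsStarProjection P ∧ ∀ l : ℕ+,
      Monotone (fun k => F k ^ (l : ℕ)) ∧ IsStrongLimit (fun k => F k ^ (l : ℕ)) P ∧
      ∀ k, F k ^ (l : ℕ) * P = F k ^ (l : ℕ) := by
  have hTF (i k) : Commute (T i) (F k) := (hF k).commute fun n => commute_orderedProd (h i) k n
  have hmono (l : ℕ) : Monotone fun k => F k ^ l := by
    refine monotone_nat_of_le_succ fun k => ?_
    have hc := hTF k (k + 1)
    -- `F k ^ l = T k ^ l * F (k + 1) ^ l`, and the first factor is at most `1`.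
    rw [← mul_tailLimit_succ hF k, hc.mul_pow]
    exact mul_le_right_of_commute (pow_mem_Icc (hT k) l).2 (pow_mem_Icc (hF' _) l).1
      (hc.pow_pow l l)
  obtain ⟨P, hP⟩ := exists_isStrongLimit_of_monotone (by simpa using hmono 1)
    (fun k => (hF' k).1) (fun k => (hF' k).2)
  have hFP (k) : F k * P = F k := by
    -- Both factors of `orderedProd T k n * F n` converge strongly, while the product equals `F k`
    -- once `n ≥ k`.
    refine IsStrongLimit.unique ((IsStrongLimit.mul (fun n => norm_le_one_of_mem_Icc
      (orderedProd_mem_Icc h hT k n)) (hF k) hP)) ((isStrongLimit_const (F k)).congr' ?_)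
    filter_upwards [eventually_ge_atTop k] with n hn
    rw [orderedProd_mul_tailLimit hF hn]
  have hPP : P * P = P := (hP.mul_const P).unique (hP.congr' (.of_forall fun k => (hFP k).symm))
  refine ⟨P, ⟨hPP, .of_nonneg (hP.nonneg fun k => (hF' k).1)⟩, fun l => ⟨hmono l, ?_, fun k => ?_⟩⟩
  · have := hP.pow (fun k => norm_le_one_of_mem_Icc (hF' k)) l
    obtain ⟨n, hn⟩ := Nat.exists_eq_succ_of_ne_zero l.ne_zero
    rwa [hn, Nat.succ_eq_add_one, IsIdempotentElem.pow_succ_eq n hPP, ← Nat.succ_eq_add_one, ← hn]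
      at this
  · obtain ⟨n, hn⟩ := Nat.exists_eq_succ_of_ne_zero l.ne_zero
    rw [hn, Nat.succ_eq_add_one, pow_succ, mul_assoc, hFP]

end OrderedProd

/-! ### Factorization and powers in `C₀(ℝ)` -/

section FunctionAlgebra

theorem ppow_apply (f : C0) (l : ℕ+) (x : ℝ) : ppow f l x = f x ^ (l : ℕ) := rfl

theorem ppow_one (f : C0) : ppow f 1 = f := by
  ext x; simp [ppow_apply]

theorem ppow_add (f : C0) (l l' : ℕ+) : ppow f (l + l') = ppow f l * ppow f l' := by
  ext x; simp [ppow_apply, pow_add]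

theorem star_ppow {f : C0} (hf : star f = f) (l : ℕ+) : star (ppow f l) = ppow f l := by
  ext x
  have := DFunLike.congr_fun hf x
  simp only [ZeroAtInftyContinuousMap.star_apply] at this
  simp [ppow_apply, this]

/-- Composition with a continuous map of the plane that fixes the origin. -/
noncomputable def postcomp (g : ℂ → ℂ) (hg : Continuous g) (h0 : g 0 = 0) (a : C0) : C0 where
  toFun x := g (a x)
  continuous_toFun := hg.comp a.continuous
  zero_at_infty' := by
    have := (hg.tendsto 0).comp (zero_at_infty a)
    rwa [h0] at this

/-- Take `b = a / √|a|` and `c = √|a|`. The quotient is continuous where `a` vanishes, since its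
modulus is `√|a|`. -/
theorem exists_mul_eq (a : C0) : ∃ b c : C0, b * c = a := by
  have hc : Continuous fun z : ℂ => ((√‖z‖ : ℝ) : ℂ) := by fun_prop
  have hb : Continuous fun z : ℂ => z / ((√‖z‖ : ℝ) : ℂ) := by
    refine continuous_iff_continuousAt.2 fun z => ?_
    rcases eq_or_ne z 0 with rfl | hz
    · have h1 : Tendsto (fun z : ℂ => √‖z‖) (𝓝 0) (𝓝 0) := by
        have : Continuous fun z : ℂ => √‖z‖ := by fun_prop
        simpa using this.tendsto 0
      have h2 : Tendsto (fun z : ℂ => z / ((√‖z‖ : ℝ) : ℂ)) (𝓝 0) (𝓝 0) := by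
        refine squeeze_zero_norm (fun w => ?_) h1
        simp [abs_of_nonneg, Real.sqrt_nonneg]
      simpa [ContinuousAt] using h2
    · refine continuousAt_id.div hc.continuousAt ?_
      simpa [Real.sqrt_eq_zero'] using hz
  refine ⟨postcomp _ hb (by simp) a, postcomp _ hc (by simp) a, ?_⟩
  ext x
  change a x / ((√‖a x‖ : ℝ) : ℂ) * ((√‖a x‖ : ℝ) : ℂ) = a x
  by_cases hx : a x = 0
  · simp [hx]
  · refine div_mul_cancel₀ _ ?_
    simpa [Real.sqrt_eq_zero'] using hx

theorem star_eq_self_of_mem_V {n : ℕ} {f : C0} (hf : f ∈ V n) : star f = f := by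
  ext x
  obtain ⟨t, -, ht⟩ := hf.1 x
  simp [ht]

/-- Intermediate value theorem between `f 0 = 1` and `f (n + 2) = 0`. At such a point the powers of
`f` are pairwise distinct. -/
theorem exists_eq_half_of_mem_V {n : ℕ} {f : C0} (hf : f ∈ V n) : ∃ x, f x = 1 / 2 := by
  have h0 : f 0 = 1 := hf.2.1 0 (by simp)
  have h1 : f (n + 2) = 0 := by
    refine image_eq_zero_of_notMem_tsupport fun h => ?_
    have := (hf.2.2 h).2
    linarith
  have hcont : Continuous fun x => (f x).re := Complex.continuous_re.comp f.continuous
  obtain ⟨x, hx⟩ := mem_range_of_exists_le_of_exists_ge (c := (1 / 2 : ℝ)) hcont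
    ⟨(n : ℝ) + 2, by simp [h1]⟩ ⟨0, by norm_num [h0]⟩
  refine ⟨x, ?_⟩
  obtain ⟨t, -, ht⟩ := hf.1 x
  simp only [ht, Complex.ofReal_re] at hx ⊢
  simp [hx]

theorem ppow_injective_of_mem_V {n : ℕ} {f : C0} (hf : f ∈ V n) :
    Function.Injective (ppow f) := by
  intro l l' h
  obtain ⟨x, hx⟩ := exists_eq_half_of_mem_V hf
  have := congrArg norm (DFunLike.congr_fun h x)
  simp only [ppow_apply, hx, norm_pow] at this
  exact PNat.coe_injective (pow_right_injective₀ (by norm_num) (by norm_num) this)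

theorem norm_le_one_of_mem_V {n : ℕ} {f : C0} (hf : f ∈ V n) : ‖f‖ ≤ 1 := by
  rw [← ZeroAtInftyContinuousMap.norm_toBCF_eq_norm,
    BoundedContinuousFunction.norm_le zero_le_one]
  intro x
  obtain ⟨t, ht, hx⟩ := hf.1 x
  change ‖f x‖ ≤ 1
  simpa [hx, abs_of_nonneg ht.1] using ht.2

theorem exists_star_mul_self_eq_of_mem_V {n : ℕ} {f : C0} (hf : f ∈ V n) :
    ∃ g : C0, f = star g * g := by
  have hc : Continuous fun z : ℂ => ((√z.re : ℝ) : ℂ) := by fun_prop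
  refine ⟨postcomp _ hc (by simp) f, ?_⟩
  ext x
  obtain ⟨t, ht, hx⟩ := hf.1 x
  change f x = star ((√(f x).re : ℝ) : ℂ) * ((√(f x).re : ℝ) : ℂ)
  simp [hx, ← Complex.ofReal_mul, Real.mul_self_sqrt ht.1]

theorem map_mem_Icc_of_mem_V {H : Type*} [NormedAddCommGroup H] [InnerProductSpace ℂ H]
    [CompleteSpace H] (φ : C0 →⋆ₙₐ[ℂ] (H →L[ℂ] H)) {n : ℕ} {f : C0} (hf : f ∈ V n) :
    φ f ∈ Set.Icc 0 1 := by
  -- Bundling the C*-structure makes automatic contractivity of *-homomorphisms available.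
  let _ : NonUnitalCStarAlgebra C0 := { }
  have h0 : 0 ≤ φ f := by
    obtain ⟨g, hg⟩ := exists_star_mul_self_eq_of_mem_V hf
    rw [hg, map_mul, map_star]
    exact star_mul_self_nonneg _
  exact ⟨h0, (CStarAlgebra.norm_le_one_iff_of_nonneg _ h0).1
    ((NonUnitalStarAlgHom.norm_apply_le φ f).trans (norm_le_one_of_mem_V hf))⟩

theorem map_ppow {H : Type*} [NormedAddCommGroup H] [InnerProductSpace ℂ H]
    [CompleteSpace H] (φ : C0 →⋆ₙₐ[ℂ] (H →L[ℂ] H)) (f : C0) (l : ℕ+) :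
    φ (ppow f l) = φ f ^ (l : ℕ) := by
  induction l using PNat.recOn with
  | one => simp [ppow_one]
  | succ l ih => rw [ppow_add, map_mul, ih, ppow_one, PNat.add_coe, PNat.one_coe, pow_succ]

end FunctionAlgebra

/-! ### Elementary tensors whose tail is a power of `f` -/

section Tails

/-- The sequence `y` eventually agrees with `f ^ l`. -/
def HasTail (f : ℕ → C0) (l : ℕ+) (y : ℕ → C0) : Prop :=
  ∀ᶠ n in atTop, y n = ppow (f n) l

theorem HasTail.update {f y : ℕ → C0} {l : ℕ+} (h : HasTail f l y) (i : ℕ) (a : C0) :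
    HasTail f l (Function.update y i a) := by
  filter_upwards [h, eventually_gt_atTop i] with n hn hi
  rw [Function.update_of_ne hi.ne', hn]

theorem hasTail_update_iff {f y : ℕ → C0} {l : ℕ+} {i : ℕ} (a : C0) :
    HasTail f l (Function.update y i a) ↔ HasTail f l y :=
  ⟨fun h => by simpa using h.update i (y i), fun h => h.update i a⟩

theorem HasTail.mul {f y y' : ℕ → C0} {l l' : ℕ+} (h : HasTail f l y) (h' : HasTail f l' y') :
    HasTail f (l + l') (y * y') := by
  filter_upwards [h, h'] with n hn hn'
  rw [Pi.mul_apply, hn, hn', ppow_add]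

theorem HasTail.star {f y : ℕ → C0} {l : ℕ+} (hf : ∀ n, star (f n) = f n) (h : HasTail f l y) :
    HasTail f l (star y) := by
  filter_upwards [h] with n hn
  rw [Pi.star_apply, hn, star_ppow (hf n)]

theorem HasTail.exponent_unique {k : ℕ → ℕ} {f y : ℕ → C0} (hf : ∀ n, f n ∈ V (k n)) {l l' : ℕ+}
    (h : HasTail f l y) (h' : HasTail f l' y) : l = l' := by
  obtain ⟨n, hn, hn'⟩ := (h.and h').exists
  exact ppow_injective_of_mem_V (hf n) (hn.symm.trans hn')

theorem HasTail.exists_tprod_eq_elem {f y : ℕ → C0} {l : ℕ+} (h : HasTail f l y) :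
    ∃ m, (∀ n, m ≤ n → y n = ppow (f n) l) ∧ PiTensorProduct.tprod ℂ y = elem f m l y := by
  obtain ⟨m, hm⟩ := eventually_atTop.1 h
  refine ⟨m, hm, congrArg _ (funext fun n => ?_)⟩
  split_ifs with hn
  · rfl
  · exact hm n (not_lt.1 hn)

theorem hasTail_elem (f : ℕ → C0) (m : ℕ) (l : ℕ+) (A : ℕ → C0) :
    HasTail f l (fun n => if n < m then A n else ppow (f n) l) := by
  filter_upwards [eventually_ge_atTop m] with n hn
  rw [if_neg hn.not_gt]

theorem tprod_mem_starAlg {f y : ℕ → C0} {l : ℕ+} (h : HasTail f l y) :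
    PiTensorProduct.tprod ℂ y ∈ starAlg f := by
  induction l using PNat.recOn generalizing y with
  | one =>
    refine NonUnitalStarAlgebra.subset_adjoin ℂ _ (Submodule.subset_span ⟨y, ?_, rfl⟩)
    have h1 : ∀ᶠ n in cofinite, y n = ppow (f n) 1 := Nat.cofinite_eq_atTop ▸ h
    have h2 : ∀ᶠ n in cofinite, f n = y n := h1.mono fun n hn => by rw [hn, ppow_one]
    exact h2
  | succ l ih =>
    obtain ⟨m, hm⟩ := eventually_atTop.1 h
    choose b c hbc using fun n => exists_mul_eq (y n)
    -- Head entries are split by `exists_mul_eq`, tail entries as `f ^ (l + 1) = f ^ l * f`; the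
    -- second factor then lies in `⟨f⟩`.
    have hy : y = (fun n => if n < m then b n else ppow (f n) l) *
        fun n => if n < m then c n else f n := by
      funext n
      by_cases hn : n < m
      · simp [hn, hbc]
      · simp [hn, hm n (not_lt.1 hn), ppow_add, ppow_one]
    rw [hy, ← PiTensorProduct.tprod_mul_tprod]
    refine mul_mem (ih (hasTail_elem f m l b)) ?_
    refine NonUnitalStarAlgebra.subset_adjoin ℂ _ (Submodule.subset_span ⟨_, ?_, rfl⟩)
    refine (Set.finite_lt_nat m).subset fun n hn => ?_
    by_contra h'
    exact hn (by simp [show ¬ n < m from h'])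

theorem elem_mem_starAlg (f : ℕ → C0) (m : ℕ) (l : ℕ+) (A : ℕ → C0) :
    elem f m l A ∈ starAlg f :=
  tprod_mem_starAlg (hasTail_elem f m l A)

/-- The elementary tensors with tail a power of `f`. -/
def tailTensors (f : ℕ → C0) : Set TensorC0 :=
  {z | ∃ l y, HasTail f l y ∧ z = PiTensorProduct.tprod ℂ y}

/-- Tail tensors are closed under products, where exponents add, and under adjoints, as the `f n`
are real. Their span is thus already a *-algebra containing `⟨f⟩`. -/
theorem starAlg_le_span {f : ℕ → C0} (hf : ∀ n, star (f n) = f n) {z : TensorC0}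
    (hz : z ∈ starAlg f) : z ∈ Submodule.span ℂ (tailTensors f) := by
  induction hz using NonUnitalStarAlgebra.adjoin_induction with
  | mem x hx =>
    refine Submodule.span_mono ?_ hx
    rintro _ ⟨y, hy, rfl⟩
    refine ⟨1, y, ?_, rfl⟩
    have h2 : ∀ᶠ n in cofinite, f n = y n := hy
    rw [Nat.cofinite_eq_atTop] at h2
    filter_upwards [h2] with n hn
    rw [ppow_one, hn]
  | add x y _ _ hx hy => exact add_mem hx hy
  | zero => exact zero_mem _
  | smul r x _ hx => exact Submodule.smul_mem _ r hx
  | mul x y hx' hy' hx hy =>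
    clear hx' hy'
    induction hx, hy using Submodule.span_induction₂ with
    | mem_mem x y hx hy =>
      obtain ⟨l, a, ha, rfl⟩ := hx
      obtain ⟨l', b, hb, rfl⟩ := hy
      exact Submodule.subset_span ⟨_, _, ha.mul hb, PiTensorProduct.tprod_mul_tprod _ _⟩
    | zero_left y hy => simp
    | zero_right x hx => simp
    | add_left x y z _ _ _ h1 h2 => rw [add_mul]; exact add_mem h1 h2
    | add_right x y z _ _ _ h1 h2 => rw [mul_add]; exact add_mem h1 h2
    | smul_left r x y _ _ h => rw [smul_mul_assoc]; exact Submodule.smul_mem _ r h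
    | smul_right r x y _ _ h => rw [mul_smul_comm]; exact Submodule.smul_mem _ r h
  | star x hx' hx =>
    clear hx'
    induction hx using Submodule.span_induction with
    | mem x hx =>
      obtain ⟨l, a, ha, rfl⟩ := hx
      exact Submodule.subset_span ⟨_, _, ha.star hf, star_tprod a⟩
    | zero => simp
    | add x y _ _ h1 h2 => rw [star_add]; exact add_mem h1 h2
    | smul r x _ h => rw [star_smul]; exact Submodule.smul_mem _ _ h

end Tails

/-! ### Construction and uniqueness of the representation -/

section TensorRepresentation

variable {H : Type*} [NormedAddCommGroup H] [InnerProductSpace ℂ H] [CompleteSpace H]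

/-- `π₀(y₀) ⋯ π_{m-1}(y_{m-1}) F_m^ℓ Q^ℓ`. -/
noncomputable def headOp (π : ℕ → C0 →⋆ₙₐ[ℂ] (H →L[ℂ] H)) (F : ℕ → H →L[ℂ] H) (Q : H →L[ℂ] H)
    (m : ℕ) (l : ℕ+) (y : ℕ → C0) : H →L[ℂ] H :=
  orderedProd (fun i => π i (y i)) 0 m * F m ^ (l : ℕ) * Q ^ (l : ℕ)

open Classical in
/-- The common value of `headOp` for large `m` if `y` has tail `f ^ l`, and `0` if `y` has no such
tail. -/
noncomputable def tailOp (f : ℕ → C0) (π : ℕ → C0 →⋆ₙₐ[ℂ] (H →L[ℂ] H)) (F : ℕ → H →L[ℂ] H)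
    (Q : H →L[ℂ] H) (y : ℕ → C0) : H →L[ℂ] H :=
  if h : ∃ p : ℕ × ℕ+, ∀ n, p.1 ≤ n → y n = ppow (f n) p.2 then
    headOp π F Q h.choose.1 h.choose.2 y else 0

theorem commute_map_tailLimit {f : ℕ → C0} {π : ℕ → C0 →⋆ₙₐ[ℂ] (H →L[ℂ] H)} {F : ℕ → H →L[ℂ] H}
    (hπ : ∀ i j a b, Commute (π i a) (π j b))
    (hF : ∀ j, IsStrongLimit (orderedProd (fun i => π i (f i)) j) (F j)) (i : ℕ) (a : C0) (j : ℕ) :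
    Commute (π i a) (F j) :=
  (hF j).commute fun n => commute_orderedProd (fun i' => hπ i i' a _) j n

theorem commute_tailLimit {f : ℕ → C0} {π : ℕ → C0 →⋆ₙₐ[ℂ] (H →L[ℂ] H)} {F : ℕ → H →L[ℂ] H}
    {Q : H →L[ℂ] H} (hQ : ∀ i a, Commute Q (π i a))
    (hF : ∀ j, IsStrongLimit (orderedProd (fun i => π i (f i)) j) (F j)) (j : ℕ) :
    Commute Q (F j) :=
  (hF j).commute fun n => commute_orderedProd (fun i' => hQ i' _) j n

theorem headOp_eq_of_le {f : ℕ → C0} {π : ℕ → C0 →⋆ₙₐ[ℂ] (H →L[ℂ] H)} {F : ℕ → H →L[ℂ] H}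
    (hπ : ∀ i j a b, Commute (π i a) (π j b))
    (hF : ∀ j, IsStrongLimit (orderedProd (fun i => π i (f i)) j) (F j)) (Q : H →L[ℂ] H)
    {m m' : ℕ} (hm : m ≤ m') {l : ℕ+} {y : ℕ → C0} (hy : ∀ n, m ≤ n → y n = ppow (f n) l) :
    headOp π F Q m' l y = headOp π F Q m l y := by
  induction m', hm using Nat.le_induction with
  | base => rfl
  | succ n hn ih =>
    rw [← ih, headOp, headOp, orderedProd_succ _ n.zero_le, hy n hn, map_ppow,
      mul_assoc (orderedProd _ _ _), ← (commute_map_tailLimit hπ hF n (f n) (n + 1)).mul_pow,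
      mul_tailLimit_succ hF]

theorem tailOp_eq_headOp {k : ℕ → ℕ} {f : ℕ → C0} (hf : ∀ n, f n ∈ V (k n))
    {π : ℕ → C0 →⋆ₙₐ[ℂ] (H →L[ℂ] H)} {F : ℕ → H →L[ℂ] H}
    (hπ : ∀ i j a b, Commute (π i a) (π j b))
    (hF : ∀ j, IsStrongLimit (orderedProd (fun i => π i (f i)) j) (F j)) (Q : H →L[ℂ] H)
    {m : ℕ} {l : ℕ+} {y : ℕ → C0} (hy : ∀ n, m ≤ n → y n = ppow (f n) l) :
    tailOp f π F Q y = headOp π F Q m l y := by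
  have h : ∃ p : ℕ × ℕ+, ∀ n, p.1 ≤ n → y n = ppow (f n) p.2 := ⟨(m, l), hy⟩
  rw [tailOp, dif_pos h]
  have h' := h.choose_spec
  generalize h.choose = p at h'
  obtain ⟨m', l'⟩ := p
  -- The chosen pair may differ from `(m, l)`: the exponents agree by uniqueness, and the cuts are
  -- compared at their maximum.
  obtain rfl : l = l' := HasTail.exponent_unique (y := y) hf (eventually_atTop.2 ⟨m, hy⟩)
    (eventually_atTop.2 ⟨m', h'⟩)
  rw [← headOp_eq_of_le hπ hF Q (le_max_left m' m) h',
    ← headOp_eq_of_le hπ hF Q (le_max_right m' m) hy]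

theorem tailOp_of_not_hasTail {f y : ℕ → C0} (π : ℕ → C0 →⋆ₙₐ[ℂ] (H →L[ℂ] H))
    (F : ℕ → H →L[ℂ] H) (Q : H →L[ℂ] H) (h : ∀ l, ¬ HasTail f l y) : tailOp f π F Q y = 0 :=
  dif_neg fun ⟨p, hp⟩ => h p.2 (eventually_atTop.2 ⟨p.1, hp⟩)

theorem headOp_update (π : ℕ → C0 →⋆ₙₐ[ℂ] (H →L[ℂ] H)) (F : ℕ → H →L[ℂ] H) (Q : H →L[ℂ] H)
    {i m : ℕ} (hi : i < m) (l : ℕ+) (y : ℕ → C0) (a : C0) :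
    headOp π F Q m l (Function.update y i a) =
      orderedProd (fun j => π j (y j)) 0 i * π i a * orderedProd (fun j => π j (y j)) (i + 1) m *
        F m ^ (l : ℕ) * Q ^ (l : ℕ) := by
  have h1 : orderedProd (fun j => π j (Function.update y i a j)) 0 i =
      orderedProd (fun j => π j (y j)) 0 i :=
    orderedProd_congr fun j _ hj => by rw [Function.update_of_ne hj.ne]
  have h2 : orderedProd (fun j => π j (Function.update y i a j)) (i + 1) m =
      orderedProd (fun j => π j (y j)) (i + 1) m :=
    orderedProd_congr fun j hj _ => by rw [Function.update_of_ne (Nat.lt_of_succ_le hj).ne']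
  rw [headOp, ← orderedProd_mul_orderedProd _ i.zero_le hi.le, orderedProd_eq_mul _ hi,
    Function.update_self, ← mul_assoc, h1, h2]

/-- `tailOp` as a multilinear map. -/
noncomputable def tailOpMultilinear {k : ℕ → ℕ} {f : ℕ → C0} (hf : ∀ n, f n ∈ V (k n))
    {π : ℕ → C0 →⋆ₙₐ[ℂ] (H →L[ℂ] H)} {F : ℕ → H →L[ℂ] H}
    (hπ : ∀ i j a b, Commute (π i a) (π j b))
    (hF : ∀ j, IsStrongLimit (orderedProd (fun i => π i (f i)) j) (F j)) (Q : H →L[ℂ] H) :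
    MultilinearMap ℂ (fun _ : ℕ => C0) (H →L[ℂ] H) :=
  have key (y : ℕ → C0) (i : ℕ) : ∃ g : C0 →ₗ[ℂ] (H →L[ℂ] H),
      ∀ a, tailOp f π F Q (Function.update y i a) = g a := by
    by_cases h : ∃ l, HasTail f l y
    · obtain ⟨l, hl⟩ := h
      obtain ⟨m, hm⟩ := eventually_atTop.1 hl
      -- Cutting at `max m (i + 1)` keeps entry `i` in the head, where it enters through the single
      -- linear factor `π i a`.
      refine ⟨LinearMap.mulRight ℂ (orderedProd (fun j => π j (y j)) (i + 1) (max m (i + 1)) *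
          F (max m (i + 1)) ^ (l : ℕ) * Q ^ (l : ℕ)) ∘ₗ
        LinearMap.mulLeft ℂ (orderedProd (fun j => π j (y j)) 0 i) ∘ₗ
        ((π i : C0 →ₗ[ℂ] (H →L[ℂ] H))), fun a => ?_⟩
      rw [tailOp_eq_headOp hf hπ hF Q (m := max m (i + 1)) (l := l), headOp_update _ _ _ (by omega)]
      · simp [mul_assoc]
      · intro n hn
        rw [Function.update_of_ne (by omega), hm n (by omega)]
    · refine ⟨0, fun a => ?_⟩
      rw [tailOp_of_not_hasTail _ _ _ fun l hl => h ⟨l, (hasTail_update_iff a).1 hl⟩]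
      rfl
  { toFun := tailOp f π F Q
    map_update_add' := fun {inst} y i a b => by
      obtain rfl : inst = instDecidableEqNat := Subsingleton.elim _ _
      obtain ⟨g, hg⟩ := key y i
      simp only [hg, map_add]
    map_update_smul' := fun {inst} y i c a => by
      obtain rfl : inst = instDecidableEqNat := Subsingleton.elim _ _
      obtain ⟨g, hg⟩ := key y i
      simp only [hg, map_smul] }

theorem headOp_mul {π : ℕ → C0 →⋆ₙₐ[ℂ] (H →L[ℂ] H)} {F : ℕ → H →L[ℂ] H}
    (hπ : ∀ i j a b, Commute (π i a) (π j b)) {Q : H →L[ℂ] H} {m : ℕ}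
    (hπF : ∀ i a, Commute (π i a) (F m)) (hQ : ∀ i a, Commute Q (π i a)) (hQF : Commute Q (F m))
    (l l' : ℕ+) (y y' : ℕ → C0) :
    headOp π F Q m (l + l') (y * y') = headOp π F Q m l y * headOp π F Q m l' y' := by
  have h1 : Commute (F m ^ (l : ℕ)) (orderedProd (fun i => π i (y' i)) 0 m) :=
    (commute_orderedProd (fun i => (hπF i _).symm) 0 m).pow_left _
  have h2 : Commute (Q ^ (l : ℕ)) (orderedProd (fun i => π i (y' i)) 0 m) :=
    (commute_orderedProd (fun i => hQ i _) 0 m).pow_left _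
  have h3 : Commute (Q ^ (l : ℕ)) (F m ^ (l' : ℕ)) := hQF.pow_pow _ _
  simp only [headOp, Pi.mul_apply, map_mul, PNat.add_coe, pow_add,
    orderedProd_mul fun i j => hπ i j (y i) (y' j)]
  rw [(h2.mul_right h3).mul_mul_mul_comm, h1.mul_mul_mul_comm]

theorem star_headOp {π : ℕ → C0 →⋆ₙₐ[ℂ] (H →L[ℂ] H)} {F : ℕ → H →L[ℂ] H}
    (hπ : ∀ i j a b, Commute (π i a) (π j b)) {Q : H →L[ℂ] H} {m : ℕ}
    (hπF : ∀ i a, Commute (π i a) (F m)) (hQ : ∀ i a, Commute Q (π i a)) (hQF : Commute Q (F m))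
    (hFs : IsSelfAdjoint (F m)) (hQs : IsSelfAdjoint Q) (l : ℕ+) (y : ℕ → C0) :
    star (headOp π F Q m l y) = headOp π F Q m l (star y) := by
  have h1 : Commute (F m ^ (l : ℕ)) (orderedProd (fun i => π i (star y i)) 0 m) :=
    (commute_orderedProd (fun i => (hπF i _).symm) 0 m).pow_left _
  have h2 : Commute (Q ^ (l : ℕ)) (orderedProd (fun i => π i (star y i)) 0 m) :=
    (commute_orderedProd (fun i => hQ i _) 0 m).pow_left _
  have h3 : Commute (Q ^ (l : ℕ)) (F m ^ (l : ℕ)) := hQF.pow_pow _ _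
  rw [headOp, headOp, star_mul, star_mul, star_pow, star_pow, hFs.star_eq, hQs.star_eq,
    star_orderedProd fun i j => hπ i j _ _,
    show (fun i => star (π i (y i))) = fun i => π i (star y i) from
      funext fun i => (map_star (π i) (y i)).symm, h1.eq, (h2.mul_right h3).eq]

/-- `Φ` is defined on the whole tensor product, which settles well-definedness; its algebraic
properties are needed only on the span of tail tensors. -/
theorem exists_tensorRepresentation {k : ℕ → ℕ} {f : ℕ → C0} (hf : ∀ n, f n ∈ V (k n))
    {π : ℕ → C0 →⋆ₙₐ[ℂ] (H →L[ℂ] H)} {F : ℕ → H →L[ℂ] H}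
    (hπ : ∀ i j a b, Commute (π i a) (π j b))
    (hF : ∀ j, IsStrongLimit (orderedProd (fun i => π i (f i)) j) (F j))
    (hFs : ∀ j, IsSelfAdjoint (F j)) {Q : H →L[ℂ] H} (hQs : IsSelfAdjoint Q)
    (hQ : ∀ i a, Commute Q (π i a)) :
    ∃ πQ : starAlg f →⋆ₙₐ[ℂ] (H →L[ℂ] H), ∀ m l A,
      πQ ⟨elem f m l A, elem_mem_starAlg f m l A⟩ = headOp π F Q m l A := by
  have hfs n := star_eq_self_of_mem_V (hf n)
  have hπF := commute_map_tailLimit hπ hF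
  have hQF := commute_tailLimit hQ hF
  set Φ : TensorC0 →ₗ[ℂ] (H →L[ℂ] H) :=
    PiTensorProduct.lift (tailOpMultilinear hf hπ hF Q) with hΦ
  have hΦt {m : ℕ} {l : ℕ+} {y : ℕ → C0} (hy : ∀ n, m ≤ n → y n = ppow (f n) l) :
      Φ (PiTensorProduct.tprod ℂ y) = headOp π F Q m l y := by
    rw [hΦ, PiTensorProduct.lift.tprod]
    exact tailOp_eq_headOp hf hπ hF Q hy
  have hmul {x y : TensorC0} (hx : x ∈ Submodule.span ℂ (tailTensors f))
      (hy : y ∈ Submodule.span ℂ (tailTensors f)) : Φ (x * y) = Φ x * Φ y := by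
    induction hx, hy using Submodule.span_induction₂ with
    | mem_mem x y hx hy =>
      obtain ⟨l, a, ha, rfl⟩ := hx
      obtain ⟨l', b, hb, rfl⟩ := hy
      obtain ⟨m, hm⟩ := eventually_atTop.1 (ha.and hb)
      rw [PiTensorProduct.tprod_mul_tprod, hΦt fun n hn => (hm n hn).1,
        hΦt fun n hn => (hm n hn).2,
        ← headOp_mul hπ (fun i a => hπF i a m) hQ (hQF m) l l' a b]
      refine hΦt fun n hn => ?_
      rw [Pi.mul_apply, (hm n hn).1, (hm n hn).2, ppow_add]
    | zero_left y hy => simp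
    | zero_right x hx => simp
    | add_left x y z _ _ _ h1 h2 => rw [add_mul, map_add, map_add, add_mul, h1, h2]
    | add_right x y z _ _ _ h1 h2 => rw [mul_add, map_add, map_add, mul_add, h1, h2]
    | smul_left r x y _ _ h => rw [smul_mul_assoc, map_smul, map_smul, smul_mul_assoc, h]
    | smul_right r x y _ _ h => rw [mul_smul_comm, map_smul, map_smul, mul_smul_comm, h]
  have hstar {x : TensorC0} (hx : x ∈ Submodule.span ℂ (tailTensors f)) :
      Φ (star x) = star (Φ x) := by
    induction hx using Submodule.span_induction with
    | mem x hx =>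
      obtain ⟨l, a, ha, rfl⟩ := hx
      obtain ⟨m, hm⟩ := eventually_atTop.1 ha
      rw [star_tprod, hΦt hm,
        star_headOp hπ (fun i a => hπF i a m) hQ (hQF m) (hFs m) hQs l a]
      refine hΦt fun n hn => ?_
      rw [Pi.star_apply, hm n hn, star_ppow (hfs n)]
    | zero => simp
    | add x y _ _ h1 h2 => rw [star_add, map_add, map_add, star_add, h1, h2]
    | smul r x _ h => rw [star_smul, map_smul, map_smul, star_smul, h]
  refine ⟨{ toFun := fun z => Φ z
            map_smul' := fun r z => map_smul Φ r (z : TensorC0)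
            map_zero' := map_zero Φ
            map_add' := fun x y => map_add Φ (x : TensorC0) y
            map_mul' := fun x y => hmul (starAlg_le_span hfs x.2) (starAlg_le_span hfs y.2)
            map_star' := fun x => hstar (starAlg_le_span hfs x.2) }, fun m l A => ?_⟩
  refine (hΦt (m := m) (l := l) fun n hn => if_neg hn.not_gt).trans ?_
  rw [headOp, headOp, orderedProd_congr (T' := fun i => π i (A i))]
  intro i _ hi
  rw [if_pos hi]

theorem tensorRepresentation_ext {f : ℕ → C0} (hfs : ∀ n, star (f n) = f n)
    {ρ ρ' : starAlg f →⋆ₙₐ[ℂ] (H →L[ℂ] H)}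
    (h : ∀ m l A, ρ ⟨elem f m l A, elem_mem_starAlg f m l A⟩ =
      ρ' ⟨elem f m l A, elem_mem_starAlg f m l A⟩) : ρ = ρ' := by
  -- Membership in `starAlg f` is part of the claim, so that `ρ` can be applied to the intermediate
  -- elements of the span induction.
  have key (z : TensorC0) (hz : z ∈ Submodule.span ℂ (tailTensors f)) :
      ∃ hz' : z ∈ starAlg f, ρ ⟨z, hz'⟩ = ρ' ⟨z, hz'⟩ := by
    induction hz using Submodule.span_induction with
    | mem x hx =>
      obtain ⟨l, a, ha, rfl⟩ := hx
      obtain ⟨m, -, hm⟩ := ha.exists_tprod_eq_elem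
      rw [hm]
      exact ⟨_, h m l a⟩
    | zero => exact ⟨zero_mem _, (map_zero ρ).trans (map_zero ρ').symm⟩
    | add x y _ _ h1 h2 =>
      obtain ⟨hx, h1⟩ := h1
      obtain ⟨hy, h2⟩ := h2
      exact ⟨add_mem hx hy, (map_add ρ ⟨x, hx⟩ ⟨y, hy⟩).trans
        ((congrArg₂ _ h1 h2).trans (map_add ρ' ⟨x, hx⟩ ⟨y, hy⟩).symm)⟩
    | smul r x _ h =>
      obtain ⟨hx, h1⟩ := h
      exact ⟨SMulMemClass.smul_mem r hx, (map_smul ρ r ⟨x, hx⟩).trans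
        ((congrArg _ h1).trans (map_smul ρ' r ⟨x, hx⟩).symm)⟩
  refine DFunLike.ext _ _ fun z => ?_
  obtain ⟨_, hz⟩ := key z (starAlg_le_span hfs z.2)
  exact hz

/-- A vector is killed by the representation as soon as it is killed by all elementary tensors with
long heads. -/
theorem tensorRepresentation_apply_eq_zero {f : ℕ → C0} (hfs : ∀ n, star (f n) = f n)
    {π : ℕ → C0 →⋆ₙₐ[ℂ] (H →L[ℂ] H)} {F : ℕ → H →L[ℂ] H} {Q : H →L[ℂ] H}
    {ρ : starAlg f →⋆ₙₐ[ℂ] (H →L[ℂ] H)}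
    (hρ : ∀ m l A, ρ ⟨elem f m l A, elem_mem_starAlg f m l A⟩ = headOp π F Q m l A) {v : H} (i : ℕ)
    (hv : ∀ m l A, i < m → headOp π F Q m l A v = 0) (z : starAlg f) : ρ z v = 0 := by
  have key (z : TensorC0) (hz : z ∈ Submodule.span ℂ (tailTensors f)) :
      ∃ hz' : z ∈ starAlg f, ρ ⟨z, hz'⟩ v = 0 := by
    induction hz using Submodule.span_induction with
    | mem x hx =>
      obtain ⟨l, a, ha, rfl⟩ := hx
      obtain ⟨m, hm⟩ := eventually_atTop.1 ha
      have he : PiTensorProduct.tprod ℂ a = elem f (max m (i + 1)) l a := by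
        refine congrArg _ (funext fun n => ?_)
        split_ifs with hn
        · rfl
        · exact hm n (by omega)
      rw [he]
      exact ⟨elem_mem_starAlg f _ l a, by rw [hρ]; exact hv _ _ _ (by omega)⟩
    | zero => exact ⟨zero_mem _, congrArg (· v) (map_zero ρ)⟩
    | add x y _ _ h1 h2 =>
      obtain ⟨hx, h1⟩ := h1
      obtain ⟨hy, h2⟩ := h2
      refine ⟨add_mem hx hy, (congrArg (· v) (map_add ρ ⟨x, hx⟩ ⟨y, hy⟩)).trans ?_⟩
      change ρ ⟨x, hx⟩ v + ρ ⟨y, hy⟩ v = 0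
      rw [h1, h2, add_zero]
    | smul r x _ h =>
      obtain ⟨hx, h1⟩ := h
      refine ⟨SMulMemClass.smul_mem r hx, (congrArg (· v) (map_smul ρ r ⟨x, hx⟩)).trans ?_⟩
      change r • ρ ⟨x, hx⟩ v = 0
      rw [h1, smul_zero]
  obtain ⟨_, hz⟩ := key z (starAlg_le_span hfs z.2)
  exact hz

end TensorRepresentation

/-! ### Essential subspaces and common kernels -/

section Nondegeneracy

variable {H : Type*} [NormedAddCommGroup H] [InnerProductSpace ℂ H] [CompleteSpace H]

/-- Since `ρ(a)* = ρ(a*)`, being orthogonal to all ranges means being killed by all adjoints. -/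
theorem mem_orthogonal_essentialSubspace_iff {B : Type*} [NonUnitalNonAssocSemiring B]
    [DistribMulAction ℂ B] [StarRing B] (ρ : B →⋆ₙₐ[ℂ] (H →L[ℂ] H)) (v : H) :
    v ∈ (essentialSubspace ρ)ᗮ ↔ ∀ a, ρ a v = 0 := by
  rw [essentialSubspace, Submodule.orthogonal_closure]
  constructor
  · intro h a
    refine ext_inner_left ℂ fun x => ?_
    have h1 := (Submodule.mem_orthogonal _ _).1 h (ρ (star a) x)
      (Submodule.subset_span ⟨star a, x, rfl⟩)
    rwa [map_star, ContinuousLinearMap.star_eq_adjoint,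
      ContinuousLinearMap.adjoint_inner_left, ← inner_zero_right x] at h1
  · intro h
    have h1 : Submodule.span ℂ {v | ∃ a x, v = ρ a x} ≤ (ℂ ∙ v)ᗮ := by
      refine Submodule.span_le.2 ?_
      rintro _ ⟨a, x, rfl⟩
      rw [SetLike.mem_coe, Submodule.mem_orthogonal_singleton_iff_inner_left,
        ← ContinuousLinearMap.adjoint_inner_right, ← ContinuousLinearMap.star_eq_adjoint,
        ← map_star, h, inner_zero_right]
    exact (Submodule.mem_orthogonal _ _).2 fun u hu =>
      Submodule.mem_orthogonal_singleton_iff_inner_left.1 (h1 hu)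

theorem isNondegenerate_iff {B : Type*} [NonUnitalNonAssocSemiring B]
    [DistribMulAction ℂ B] [StarRing B] (ρ : B →⋆ₙₐ[ℂ] (H →L[ℂ] H)) :
    IsNondegenerate ρ ↔ ∀ v, (∀ a, ρ a v = 0) → v = 0 := by
  have hcl : IsClosed (essentialSubspace ρ : Set H) := Submodule.isClosed_topologicalClosure _
  have : CompleteSpace (essentialSubspace ρ) := hcl.completeSpace_coe
  rw [IsNondegenerate, ← Submodule.orthogonal_eq_bot_iff, Submodule.eq_bot_iff]
  simp only [mem_orthogonal_essentialSubspace_iff]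

theorem eq_zero_of_orderedProd_apply_eq_zero {π : ℕ → C0 →⋆ₙₐ[ℂ] (H →L[ℂ] H)}
    (hn : ∀ i, IsNondegenerate (π i)) (m : ℕ) {u : H}
    (h : ∀ A : ℕ → C0, orderedProd (fun i => π i (A i)) 0 m u = 0) : u = 0 := by
  induction m generalizing u with
  | zero => simpa [orderedProd] using h 0
  | succ m ih =>
    refine (isNondegenerate_iff _).1 (hn m) u fun a => ih fun A => ?_
    have h1 := h (Function.update A m a)
    rw [orderedProd_succ _ m.zero_le, Function.update_self,
      orderedProd_congr (T' := fun i => π i (A i))] at h1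
    · exact h1
    · intro i _ hi
      rw [Function.update_of_ne hi.ne]

/-- Exponent `1` suffices for one direction: injectivity of `Q` and non-degeneracy of the `π i`
strip everything but `F m`, and `F m v → P v`. The other direction is `F m v = F m (P v)`. -/
theorem tensorRepresentation_kernel {f : ℕ → C0} (hfs : ∀ n, star (f n) = f n)
    {π : ℕ → C0 →⋆ₙₐ[ℂ] (H →L[ℂ] H)} {F : ℕ → H →L[ℂ] H} {P Q : H →L[ℂ] H}
    (hFP : ∀ j, F j * P = F j) (hP : IsStrongLimit F P) (hQF : ∀ j, Commute Q (F j))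
    {ρ : starAlg f →⋆ₙₐ[ℂ] (H →L[ℂ] H)}
    (hρ : ∀ m l A, ρ ⟨elem f m l A, elem_mem_starAlg f m l A⟩ = headOp π F Q m l A)
    (hQ : LinearMap.ker (Q : H →ₗ[ℂ] H) = ⊥) (hn : ∀ i, IsNondegenerate (π i)) (v : H) :
    (∀ z, ρ z v = 0) ↔ P v = 0 := by
  constructor
  · intro h
    have h1 (m : ℕ) : F m v = 0 := by
      refine LinearMap.ker_eq_bot'.1 hQ _ (eq_zero_of_orderedProd_apply_eq_zero hn m fun A => ?_)
      have h2 := h ⟨_, elem_mem_starAlg f m 1 A⟩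
      rw [hρ, headOp, PNat.one_coe, pow_one, pow_one, mul_assoc, ← (hQF m).eq] at h2
      exact h2
    exact tendsto_nhds_unique (hP v) (by simp [h1])
  · intro h
    refine tensorRepresentation_apply_eq_zero hfs hρ 0 fun m l A _ => ?_
    have h1 : F m v = 0 := by rw [← hFP m]; change F m (P v) = 0; rw [h, map_zero]
    -- As `l ≥ 1`, one factor `F m` can be moved to act first on `v`.
    obtain ⟨n, hn⟩ := Nat.exists_eq_succ_of_ne_zero l.ne_zero
    rw [headOp, mul_assoc, ← ((hQF m).pow_pow _ _).eq, hn, pow_succ (F m)]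
    simp [h1]

/-- `ker P` is the orthogonal complement of the closed essential subspace, and the range of an
orthogonal projection is `(ker P)ᗮ`. -/
theorem range_eq_essentialSubspace {B : Type*} [NonUnitalNonAssocSemiring B]
    [DistribMulAction ℂ B] [StarRing B] {ρ : B →⋆ₙₐ[ℂ] (H →L[ℂ] H)} {P : H →L[ℂ] H}
    (hP : IsStarProjection P) (h : ∀ v, (∀ a, ρ a v = 0) ↔ P v = 0) :
    LinearMap.range (P : H →ₗ[ℂ] H) = essentialSubspace ρ := by
  have hcl : IsClosed (essentialSubspace ρ : Set H) := Submodule.isClosed_topologicalClosure _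
  have : CompleteSpace (essentialSubspace ρ) := hcl.completeSpace_coe
  have hPP (x : H) : P (P x) = P x := congrArg (· x) hP.isIdempotentElem.eq
  have hin (x y : H) : ⟪P x, y⟫_ℂ = ⟪x, P y⟫_ℂ := by
    rw [← ContinuousLinearMap.adjoint_inner_right, hP.isSelfAdjoint.adjoint_eq]
  rw [← Submodule.orthogonal_orthogonal (essentialSubspace ρ)]
  refine le_antisymm ?_ fun x hx => ?_
  · rintro _ ⟨x, rfl⟩
    refine (Submodule.mem_orthogonal' _ _).2 fun v hv => ?_
    rw [mem_orthogonal_essentialSubspace_iff, h] at hv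
    change ⟪P x, v⟫_ℂ = 0
    rw [hin, hv, inner_zero_right]
  · have h1 : P (x - P x) = 0 := by rw [map_sub, hPP, sub_self]
    have h2 := (Submodule.mem_orthogonal _ _).1 hx (x - P x)
      ((mem_orthogonal_essentialSubspace_iff ρ _).2 ((h _).2 h1))
    have h3 : ⟪x - P x, x - P x⟫_ℂ = 0 := by
      rw [inner_sub_right, h2, ← hin, h1, inner_zero_left, sub_zero]
    exact ⟨x, (sub_eq_zero.1 (inner_self_eq_zero.1 h3)).symm⟩

theorem tensorRepresentation_isNondegenerate_iff {k : ℕ → ℕ} {f : ℕ → C0}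
    (hf : ∀ n, f n ∈ V (k n)) {π : ℕ → C0 →⋆ₙₐ[ℂ] (H →L[ℂ] H)} {F : ℕ → H →L[ℂ] H}
    {P Q : H →L[ℂ] H} (hπ : ∀ i j a b, Commute (π i a) (π j b))
    (hF : ∀ j, IsStrongLimit (orderedProd (fun i => π i (f i)) j) (F j))
    (hFP : ∀ j, F j * P = F j) (hP : IsStrongLimit F P) (hPs : IsStarProjection P)
    (hQ : ∀ i a, Commute Q (π i a)) {ρ : starAlg f →⋆ₙₐ[ℂ] (H →L[ℂ] H)}
    (hρ : ∀ m l A, ρ ⟨elem f m l A, elem_mem_starAlg f m l A⟩ = headOp π F Q m l A) :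
    IsNondegenerate ρ ↔ (∀ i, IsNondegenerate (π i)) ∧ P = 1 ∧
      LinearMap.ker (Q : H →ₗ[ℂ] H) = ⊥ := by
  have hfs n := star_eq_self_of_mem_V (hf n)
  have hπF := commute_map_tailLimit hπ hF
  have hQF := commute_tailLimit hQ hF
  constructor
  · intro hn
    rw [isNondegenerate_iff] at hn
    refine ⟨fun i => (isNondegenerate_iff _).2 fun v hv => hn v ?_, ?_, ?_⟩
    · refine tensorRepresentation_apply_eq_zero hfs hρ i fun m l A hi => ?_
      -- The trivial update isolates the factor `π i (A i)`, which then commutes to the right and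
      -- kills `v`.
      have h1 : headOp π F Q m l A = headOp π F Q m l (Function.update A i (A i)) := by simp
      have hc : Commute (π i (A i)) (orderedProd (fun j => π j (A j)) (i + 1) m * F m ^ (l : ℕ) *
          Q ^ (l : ℕ)) :=
        ((commute_orderedProd (fun j => hπ i j _ _) _ _).mul_right
          ((hπF i _ m).pow_right _)).mul_right ((hQ i _).symm.pow_right _)
      rw [h1, headOp_update _ _ _ hi, mul_assoc, mul_assoc, mul_assoc, ← mul_assoc _ _ (Q ^ _),
        hc.eq, ← mul_assoc]
      exact mul_apply_eq_zero _ (hv _)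
    · ext v
      -- Every `F m` kills `v - P v`, because `F m * P = F m`.
      refine (sub_eq_zero.1 (hn (v - P v) ?_)).symm
      refine tensorRepresentation_apply_eq_zero hfs hρ 0 fun m l A _ => ?_
      have hw : F m (v - P v) = 0 := by
        rw [map_sub]
        exact sub_eq_zero.2 (congrArg (· v) (hFP m)).symm
      obtain ⟨n, hl⟩ := Nat.exists_eq_succ_of_ne_zero l.ne_zero
      rw [headOp, mul_assoc, ← ((hQF m).pow_pow _ _).eq, hl, pow_succ (F m)]
      simp only [← mul_assoc]
      exact mul_apply_eq_zero _ hw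
    · refine LinearMap.ker_eq_bot'.2 fun v hv => hn v ?_
      refine tensorRepresentation_apply_eq_zero hfs hρ 0 fun m l A _ => ?_
      obtain ⟨n, hl⟩ := Nat.exists_eq_succ_of_ne_zero l.ne_zero
      rw [headOp, hl, pow_succ Q, ← mul_assoc]
      exact mul_apply_eq_zero _ hv
  · rintro ⟨hn, rfl, hQ0⟩
    refine (isNondegenerate_iff _).2 fun v hv => ?_
    exact (tensorRepresentation_kernel hfs hFP hP hQF hρ hQ0 hn v).1 hv

end Nondegeneracy

end InfTensor

/-! ### Assembly of the four parts -/

theorem mainTheorem7 {H : Type*} [NormedAddCommGroup H] [InnerProductSpace ℂ H] [CompleteSpace H]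
    (k : ℕ → ℕ) (f : ℕ → InfTensor.C0) (hf : ∀ n, f n ∈ InfTensor.V (k n))
    (π : ℕ → InfTensor.C0 →⋆ₙₐ[ℂ] (H →L[ℂ] H))
    (hπ : ∀ i j a b, Commute (π i a) (π j b)) :
    ∃ F : ℕ → ℕ+ → H →L[ℂ] H,
      (∀ j l, InfTensor.IsStrongLimit
        (fun n => InfTensor.orderedProd (fun i => π i (InfTensor.ppow (f i) l)) j n) (F j l)) ∧
      (∀ j l, 0 ≤ F j l ∧ F j l ≤ 1) ∧
      ∃ P : H →L[ℂ] H, IsStarProjection P ∧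
        (∀ l, Monotone (fun j => F j l) ∧ InfTensor.IsStrongLimit (fun j => F j l) P ∧
          ∀ j, F j l * P = F j l) ∧
        ∀ Q : H →L[ℂ] H, 0 ≤ Q → Q ≤ 1 → (∀ i a, Commute Q (π i a)) →
          ∃ hmem : ∀ m l A, InfTensor.elem f m l A ∈ InfTensor.starAlg f,
          ∃ πQ : InfTensor.starAlg f →⋆ₙₐ[ℂ] (H →L[ℂ] H),
            (∀ m l A, πQ ⟨InfTensor.elem f m l A, hmem m l A⟩ =
              InfTensor.orderedProd (fun i => π i (A i)) 0 m * F m l * Q ^ (l : ℕ)) ∧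
            (∀ ρ : InfTensor.starAlg f →⋆ₙₐ[ℂ] (H →L[ℂ] H),
              (∀ m l A, ρ ⟨InfTensor.elem f m l A, hmem m l A⟩ =
                InfTensor.orderedProd (fun i => π i (A i)) 0 m * F m l * Q ^ (l : ℕ)) → ρ = πQ) ∧
            (InfTensor.IsNondegenerate πQ ↔
              (∀ i, InfTensor.IsNondegenerate (π i)) ∧ P = 1 ∧
                LinearMap.ker (Q : H →ₗ[ℂ] H) = ⊥) ∧
            (¬ InfTensor.IsNondegenerate πQ → LinearMap.ker (Q : H →ₗ[ℂ] H) = ⊥ →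
              (∀ i, InfTensor.IsNondegenerate (π i)) →
                LinearMap.range (P : H →ₗ[ℂ] H) = InfTensor.essentialSubspace πQ) := by
  have hIcc i : π i (f i) ∈ Set.Icc 0 1 := InfTensor.map_mem_Icc_of_mem_V (π i) (hf i)
  have hcomm i j : Commute (π i (f i)) (π j (f j)) := hπ i j _ _
  obtain ⟨F, hF, hF'⟩ := InfTensor.exists_tailLimit hcomm hIcc
  obtain ⟨P, hP, hFP⟩ := InfTensor.exists_tailProjection hcomm hIcc hF hF'
  have hFP1 := hFP 1
  simp only [PNat.one_coe, pow_one] at hFP1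
  -- The limit for exponent `l` is the `l`-th power of the limit for exponent `1`.
  refine ⟨fun j l => F j ^ (l : ℕ), fun j l => ?_,
    fun j l => InfTensor.pow_mem_Icc (hF' j) l, P, hP, hFP, fun Q hQ0 _ hQ => ?_⟩
  · simp only [InfTensor.map_ppow, InfTensor.orderedProd_pow hcomm]
    exact (hF j).pow (fun n => InfTensor.norm_le_one_of_mem_Icc
      (InfTensor.orderedProd_mem_Icc hcomm hIcc j n)) l
  obtain ⟨ρ, hρ⟩ := InfTensor.exists_tensorRepresentation hf hπ hF
    (fun j => .of_nonneg (hF' j).1) (.of_nonneg hQ0) hQ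
  have hfs n := InfTensor.star_eq_self_of_mem_V (hf n)
  refine ⟨InfTensor.elem_mem_starAlg f, ρ, hρ, fun ρ' hρ' => ?_, ?_, fun _ hQ1 hn => ?_⟩
  · exact InfTensor.tensorRepresentation_ext hfs fun m l A => (hρ' m l A).trans (hρ m l A).symm
  · exact InfTensor.tensorRepresentation_isNondegenerate_iff hf hπ hF hFP1.2.2 hFP1.2.1 hP hQ hρ
  · exact InfTensor.range_eq_essentialSubspace hP
      (InfTensor.tensorRepresentation_kernel hfs hFP1.2.2 hFP1.2.1
        (InfTensor.commute_tailLimit hQ hF) hρ hQ1 hn)
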